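/- Let $n\ge 3$ and consider $n$ parties $A_1,\dots,A_n$. A pure state shared by the parties is a unit vector in $\bigotimes_{v}\mathcal H_v$, where the finite-dimensional space $\mathcal H_v$ is the system held by party $A_v$. We say that $\psi$ can be converted to $\varphi$ by LOCC if some protocol of finitely many rounds maps $|\psi\rangle\langle\psi|$ to $|\varphi\rangle\langle\varphi|$ exactly and with certainty; in each round every party performs a quantum measurement with finitely many outcomes on her own system (this includes unitaries, adding ancillas, discarding subsystems, and doing nothing), the choice of which may depend on all outcomes announced in earlier rounds, and then announces her outcome to all parties. Write $\varphi <_{LOCC} \psi$ if $\psi$ can be converted to $\varphi$ by LOCC but $\varphi$ cannot be converted to $\psi$ by LOCC. For $i\ne j$ let $\mathrm{EPR}_{ij}$ be the state in which $A_i$ and $A_j$ share one EPR pair $(|00\rangle+|11\rangle)/\sqrt2$ and the other parties hold nothing. Let $n\text{-CAT}$ be the state $(|0\cdots0\rangle+|1\cdots1\rangle)/\sqrt2$ of $n$ qubits, one with each party. For a spanning tree $T$ on the $n$ parties let $\mathrm{EPR}(T)$ be the spanning EPR tree, that is, the tensor product of $n-1$ EPR pairs, one for each edge of $T$, shared by the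 two ends of that edge. Then for all $i\neq j$ and every spanning tree $T$ on the $n$ parties, $$\mathrm{EPR}_{ij} \;<_{LOCC}\; n\text{-CAT} \;<_{LOCC}\; \mathrm{EPR}(T).$$ That is: the $n$-CAT state can be converted by LOCC to an EPR pair between any two parties, but no single EPR pair can be converted by LOCC to the $n$-CAT state; and every spanning EPR tree can be converted by LOCC to the $n$-CAT state, but the $n$-CAT state cannot be converted by LOCC to any spanning EPR tree. -/

import Mathlib

open scoped Matrix BigOperators

noncomputable section

namespace LOCC

/-- A finite-dimensional quantum system `ℂ^Basis`, given by its computational basis. -/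
structure QSystem where
  Basis : Type
  [fintypeBasis : Fintype Basis]
  [decEqBasis : DecidableEq Basis]

attribute [instance] QSystem.fintypeBasis QSystem.decEqBasis

/-- The computational basis of the joint system `⨂ v, ℂ^(S v).Basis`, where party `v` holds the
system `S v`. -/
abbrev JointBasis {V : Type} (S : V → QSystem) : Type := ∀ v, (S v).Basis

/-- The operator `⨂ v, K v`, where party `v` applies `K v` to her own system. -/
def tensorOp {V : Type} [Fintype V] {S S' : V → QSystem}
    (K : ∀ v, Matrix (S' v).Basis (S v).Basis ℂ) :
    Matrix (JointBasis S') (JointBasis S) ℂ :=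
  Matrix.of fun x y => ∏ v, K v (x v) (y v)

/-- Protocols of local operations and classical communication (finitely many rounds) between the
parties `V`, which turn systems `S` into systems `S'`.

In a round, every party `v` performs on her own system a quantum measurement with Kraus operators
`K v a`, `a : Fin (m v)`, the completeness relation `∑ a, (K v a)ᴴ * K v a = 1` being the only
constraint; then all outcomes are announced to all parties, and the rest of the protocol may depend
on them. A unitary, or the addition of an ancilla, is a measurement with one outcome (a unitary, or
an isometry into a larger system); discarding a subsystem is the measurement with Kraus operators
`⟨a| ⊗ 1` whose outcome is not used later; a party with the single Kraus operator `1` does nothing,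
so that protocols in which only one party acts at a time are included. -/
inductive Protocol {V : Type} [Fintype V] [DecidableEq V] :
    (V → QSystem) → (V → QSystem) → Type 1
  | done (S : V → QSystem) : Protocol S S
  | round {S S₁ S' : V → QSystem} (m : V → ℕ)
      (K : ∀ v, Fin (m v) → Matrix (S₁ v).Basis (S v).Basis ℂ)
      (complete : ∀ v, ∑ a, (K v a)ᴴ * K v a = 1)
      (next : (∀ v, Fin (m v)) → Protocol S₁ S') : Protocol S S'

/-- The density operator that a protocol outputs on input `ρ` (the average over all outcomes: each
branch contributes its post-measurement state, weighted by its probability). -/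
def Protocol.run {V : Type} [Fintype V] [DecidableEq V] {S S' : V → QSystem} :
    Protocol S S' → Matrix (JointBasis S) (JointBasis S) ℂ →
      Matrix (JointBasis S') (JointBasis S') ℂ
  | .done _, ρ => ρ
  | .round _ K _ next, ρ =>
      ∑ a, (next a).run
        (tensorOp (fun v => K v (a v)) * ρ * (tensorOp (fun v => K v (a v)))ᴴ)

/-- A pure state vector shared by the parties `V`: the systems they hold and the amplitudes in the
joint computational basis. -/
structure SharedState (V : Type) where
  sys : V → QSystem
  amp : JointBasis sys → ℂ

/-- The density operator `|ψ⟩⟨ψ|`. -/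
def SharedState.density {V : Type} (ψ : SharedState V) :
    Matrix (JointBasis ψ.sys) (JointBasis ψ.sys) ℂ :=
  Matrix.vecMulVec ψ.amp (star ψ.amp)

/-- `ψ` can be converted to `φ` (exactly and with certainty) by LOCC. -/
def Convertible {V : Type} [Fintype V] [DecidableEq V] (ψ φ : SharedState V) : Prop :=
  ∃ P : Protocol ψ.sys φ.sys, P.run ψ.density = φ.density

/-- The strict order `φ <_LOCC ψ`: `ψ` can be converted to `φ` by LOCC, but not conversely. -/
def StrictlyWeaker {V : Type} [Fintype V] [DecidableEq V] (φ ψ : SharedState V) : Prop :=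
  Convertible ψ φ ∧ ¬ Convertible φ ψ

/-- Amplitude at `|y⟩` of the CAT state `(|0…0⟩ + |1…1⟩) / √2` of qubits indexed by `α`. -/
def catAmp {α : Type} [Fintype α] (y : α → Fin 2) : ℂ :=
  ((if ∀ u, y u = 0 then 1 else 0) + (if ∀ u, y u = 1 then 1 else 0)) / (Real.sqrt 2 : ℂ)

/-- The state of an entangled hypergraph on `V` with hyperedges `E k`, `k : κ`: for every `k`, the
parties in `E k` share a CAT state, one qubit each (an EPR pair if `E k` has two elements). Party
`v` holds one qubit for every hyperedge that contains `v` (a trivial one-dimensional system if there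
is none), and the joint state is the tensor product of all these CAT states. -/
def hypergraphState {V κ : Type} [DecidableEq V] [Fintype κ] [DecidableEq κ]
    (E : κ → Finset V) : SharedState V where
  sys v := { Basis := {k : κ // v ∈ E k} → Fin 2 }
  amp x := ∏ k, catAmp fun u : {u : V // u ∈ E k} => x u.1 ⟨k, u.2⟩

/-- One EPR pair shared by the parties `i` and `j`; the other parties hold nothing. -/
def eprPair {V : Type} [DecidableEq V] (i j : V) : SharedState V :=
  hypergraphState fun _ : Unit => {i, j}

/-- The CAT state shared by all parties. -/
def catState (V : Type) [Fintype V] [DecidableEq V] : SharedState V :=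
  hypergraphState fun _ : Unit => (Finset.univ : Finset V)

/-- The EPR graph `G`: one EPR pair for every edge of `G`, shared by its two ends. -/
def eprGraph {V : Type} [Fintype V] [DecidableEq V] (G : SimpleGraph V) [DecidableRel G.Adj] :
    SharedState V :=
  hypergraphState fun e : G.edgeSet => e.1.toFinset

end LOCC

end

/-!
# EPR pairs, CAT states and spanning EPR trees under LOCC

**Conversions that exist.** Total probability is preserved by a protocol, so a measurement whose
every branch can be rotated locally into a multiple of the target state is already a conversion
(`LOCC.convertible_of_branches`); the weights need not be computed. For the CAT state, the parties
other than `i` and `j` measure in the basis `(|0⟩ ± |1⟩) / √2`, and `i` corrects the sign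
(`LOCC.convertible_catState_restrict`). For a spanning EPR tree, every party measures the parities
of her qubits and keeps a single one; the relative shifts between neighbours are then known, and on
a tree they come from a potential, which tells every party whether to flip her qubit
(`LOCC.convertible_eprGraph_catState`, `LOCC.exists_potential_of_isTree`).

**Conversions that do not exist.** A protocol maps `ρ` to a sum of conjugates of `ρ` by product
operators. If the output is pure, every branch is proportional to it, so some product operator maps
the first state to a nonzero multiple of the second (`LOCC.Convertible.exists_tensorOp`). From an
EPR pair, such an operator leaves a third party uncorrelated with the rest, which she is not in the
CAT state (`LOCC.not_convertible_catState`). From the CAT state, it yields Schmidt rank at most two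
between one party and the rest; but a party of degree at least two in a tree has Schmidt rank at
least four (of which three is enough) in the EPR tree (`LOCC.not_convertible_hypergraphState`).
-/

namespace LOCC

section Protocols

variable {V : Type} [Fintype V]

/-! ### Product operators -/

lemma tensorOp_one (S : V → QSystem) :
    tensorOp (fun v => (1 : Matrix (S v).Basis (S v).Basis ℂ)) = 1 := by
  ext x y
  simp only [tensorOp, Matrix.of_apply, Matrix.one_apply, Finset.prod_ite_zero, funext_iff,
    Finset.mem_univ, true_imp_iff, Finset.prod_const_one]

lemma conjTranspose_tensorOp {S S' : V → QSystem}
    (K : ∀ v, Matrix (S' v).Basis (S v).Basis ℂ) :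
    (tensorOp K)ᴴ = tensorOp fun v => (K v)ᴴ := by
  ext x y
  simp [tensorOp, Matrix.conjTranspose_apply]

variable [DecidableEq V]

lemma tensorOp_mul {S S₁ S' : V → QSystem} (L : ∀ v, Matrix (S' v).Basis (S₁ v).Basis ℂ)
    (K : ∀ v, Matrix (S₁ v).Basis (S v).Basis ℂ) :
    tensorOp L * tensorOp K = tensorOp fun v => L v * K v := by
  ext x y
  simp only [tensorOp, Matrix.mul_apply, Matrix.of_apply, ← Finset.prod_mul_distrib]
  rw [Finset.prod_univ_sum, Fintype.piFinset_univ]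

lemma sum_tensorOp {S S' : V → QSystem} {m : V → ℕ}
    (K : ∀ v, Fin (m v) → Matrix (S' v).Basis (S v).Basis ℂ) :
    ∑ a : ∀ v, Fin (m v), tensorOp (fun v => K v (a v)) = tensorOp fun v => ∑ a, K v a := by
  ext x y
  simp only [tensorOp, Matrix.sum_apply, Matrix.of_apply]
  rw [Finset.prod_univ_sum, Fintype.piFinset_univ]

/-- The matrix that sends the amplitudes `ψ` to `x ↦ c x * ψ (f x)`: row `x` has the single
entry `c x`, in column `f x`. -/
def monomialMatrix {X Y : Type} [DecidableEq Y] (c : X → ℂ) (f : X → Y) : Matrix X Y ℂ :=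
  Matrix.of fun x y => if y = f x then c x else 0

lemma monomialMatrix_conjTranspose_mul_self {X Y : Type} [Fintype X] [DecidableEq Y]
    (c : X → ℂ) (f : X → Y) :
    (monomialMatrix c f)ᴴ * monomialMatrix c f =
      Matrix.diagonal fun y => ∑ x, if y = f x then star (c x) * c x else 0 := by
  ext y y'
  simp only [Matrix.mul_apply, Matrix.conjTranspose_apply, monomialMatrix, Matrix.of_apply,
    Matrix.diagonal_apply]
  split_ifs with h
  · subst h
    exact Finset.sum_congr rfl fun x _ => by split_ifs <;> simp
  · refine Finset.sum_eq_zero fun x _ => ?_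
    by_cases hy : y = f x
    · rw [if_neg (c := y' = f x) fun h' => h (hy.trans h'.symm), mul_zero]
    · rw [if_neg (c := y = f x) hy, star_zero, zero_mul]

lemma monomialMatrix_equiv_conjTranspose_mul_self {X Y : Type} [Fintype X] [DecidableEq Y]
    (c : X → ℂ) (f : X ≃ Y) {r : ℂ} (hc : ∀ x, star (c x) * c x = r) :
    (monomialMatrix c f)ᴴ * monomialMatrix c f = r • 1 := by
  classical
  rw [monomialMatrix_conjTranspose_mul_self, Matrix.smul_one_eq_diagonal]
  congr 1
  funext y
  simp only [hc, ← f.symm_apply_eq, Finset.sum_ite_eq, Finset.mem_univ, if_true]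

lemma tensorOp_monomialMatrix_mulVec {S S' : V → QSystem} (c : ∀ v, (S' v).Basis → ℂ)
    (f : ∀ v, (S' v).Basis → (S v).Basis) (ψ : JointBasis S → ℂ) (x : JointBasis S') :
    (tensorOp (S := S) (S' := S') (fun v => monomialMatrix (c v) (f v)) *ᵥ ψ) x =
      (∏ v, c v (x v)) * ψ fun v => f v (x v) := by
  simp only [Matrix.mulVec, dotProduct, tensorOp, monomialMatrix, Matrix.of_apply]
  rw [Finset.sum_eq_single fun v => f v (x v)]
  · simp
  · intro y _ hy
    obtain ⟨v, hv⟩ := Function.ne_iff.1 hy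
    rw [Finset.prod_eq_zero (Finset.mem_univ v) (if_neg hv), zero_mul]
  · simp

lemma mul_vecMulVec_mul_conjTranspose {m n : Type*} [Fintype m] [Fintype n] (M : Matrix m n ℂ)
    (w : n → ℂ) :
    M * Matrix.vecMulVec w (star w) * Mᴴ = Matrix.vecMulVec (M *ᵥ w) (star (M *ᵥ w)) := by
  rw [Matrix.mul_vecMulVec, Matrix.vecMulVec_mul, Matrix.star_mulVec]

/-! ### Protocols on pure states -/

/-- Measurements preserve total probability. -/
lemma Protocol.trace_run {S S' : V → QSystem} (P : Protocol S S')
    (ρ : Matrix (JointBasis S) (JointBasis S) ℂ) : (P.run ρ).trace = ρ.trace := by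
  induction P with
  | done S => rfl
  | round m K complete next ih =>
    simp only [Protocol.run, Matrix.trace_sum, ih]
    calc _ = ∑ a : ∀ v, Fin (m v), ((tensorOp fun v => (K v (a v))ᴴ * K v (a v)) * ρ).trace := by
          refine Finset.sum_congr rfl fun a _ => ?_
          rw [Matrix.trace_mul_comm, ← Matrix.mul_assoc, conjTranspose_tensorOp, tensorOp_mul]
      _ = ρ.trace := by
          rw [← Matrix.trace_sum, ← Finset.sum_mul,
            sum_tensorOp (fun v a => (K v a)ᴴ * K v a)]
          simp only [complete, tensorOp_one, one_mul]

/-- Every protocol acts as a sum of conjugations by product operators, one for each branch. -/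
lemma Protocol.exists_run_eq_sum {S S' : V → QSystem} (P : Protocol S S') :
    ∃ (ι : Type) (_ : Fintype ι) (L : ι → ∀ v, Matrix (S' v).Basis (S v).Basis ℂ),
      ∀ ρ, P.run ρ = ∑ b, tensorOp (L b) * ρ * (tensorOp (L b))ᴴ := by
  induction P with
  | done S => exact ⟨Unit, inferInstance, fun _ _ => 1, fun ρ => by
      simp [Protocol.run, tensorOp_one]⟩
  | round m K complete next ih =>
    choose ι hι L hL using ih
    refine ⟨Σ a, ι a, inferInstance, fun b v => L b.1 b.2 v * K v (b.1 v), fun ρ => ?_⟩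
    simp only [Protocol.run, hL, Fintype.sum_sigma, ← tensorOp_mul, Matrix.conjTranspose_mul,
      Matrix.mul_assoc]

/-- If a mixture of the pure states `w b` is the pure state `φ`, then each `w b` is proportional
to `φ`, and not all of them vanish. -/
lemma exists_smul_eq_of_sum_vecMulVec {X ι : Type*} [Fintype ι] {w : ι → X → ℂ}
    {φ : X → ℂ} (hφ : φ ≠ 0)
    (h : ∑ b, Matrix.vecMulVec (w b) (star (w b)) = Matrix.vecMulVec φ (star φ)) :
    ∃ b, ∃ c : ℂ, c ≠ 0 ∧ w b = c • φ := by
  have H (x y : X) : ∑ b, w b x * star (w b y) = φ x * star (φ y) := by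
    simpa [Matrix.sum_apply, Matrix.vecMulVec_apply] using congrFun (congrFun h x) y
  obtain ⟨x, hx⟩ := Function.ne_iff.1 hφ
  have hx : φ x ≠ 0 := hx
  obtain ⟨b, hb⟩ : ∃ b, w b x ≠ 0 := by
    by_contra! h0
    have := H x x
    simp [h0, hx] at this
  -- The functional `u ↦ φ x * u y - φ y * u x` kills `φ`, hence every `w b`.
  have key (y : X) : φ x * w b y - φ y * w b x = 0 := by
    have h0 : ∑ b, (φ x * w b y - φ y * w b x) * star (φ x * w b y - φ y * w b x) = 0 := by
      calc _ = φ x * star (φ x) * ∑ b, w b y * star (w b y)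
            - φ x * star (φ y) * ∑ b, w b y * star (w b x)
            - φ y * star (φ x) * ∑ b, w b x * star (w b y)
            + φ y * star (φ y) * ∑ b, w b x * star (w b x) := by
            simp only [Finset.mul_sum, ← Finset.sum_sub_distrib, ← Finset.sum_add_distrib]
            refine Finset.sum_congr rfl fun b _ => ?_
            simp only [star_sub, star_mul']
            ring
        _ = 0 := by simp only [H]; ring
    have h1 : ∑ b, Complex.normSq (φ x * w b y - φ y * w b x) = 0 := by
      have h2 : ((∑ b, Complex.normSq (φ x * w b y - φ y * w b x) : ℝ) : ℂ) = 0 := by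
        rw [← h0, Complex.ofReal_sum]
        exact Finset.sum_congr rfl fun b _ => (Complex.mul_conj _).symm
      exact_mod_cast h2
    exact Complex.normSq_eq_zero.1
      ((Finset.sum_eq_zero_iff_of_nonneg fun b _ => Complex.normSq_nonneg _).1 h1 b
        (Finset.mem_univ b))
  refine ⟨b, w b x / φ x, div_ne_zero hb hx, funext fun y => ?_⟩
  have := key y
  simp only [Pi.smul_apply, smul_eq_mul]
  field_simp
  linear_combination this

/-- An LOCC conversion between pure states yields a product operator that maps the first state
to a nonzero multiple of the second. -/
lemma Convertible.exists_tensorOp {ψ φ : SharedState V} (h : Convertible ψ φ)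
    (hφ : φ.amp ≠ 0) :
    ∃ (L : ∀ v, Matrix (φ.sys v).Basis (ψ.sys v).Basis ℂ) (c : ℂ), c ≠ 0 ∧
      tensorOp L *ᵥ ψ.amp = c • φ.amp := by
  obtain ⟨P, hP⟩ := h
  obtain ⟨ι, _, L, hL⟩ := P.exists_run_eq_sum
  rw [hL] at hP
  simp only [SharedState.density, mul_vecMulVec_mul_conjTranspose] at hP
  obtain ⟨b, c, hc, hb⟩ := exists_smul_eq_of_sum_vecMulVec hφ hP
  exact ⟨L b, c, hc, hb⟩

/-- A measurement by every party, followed by isometries `U a` that depend on the outcomes `a`,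
converts `ψ` to `φ` as soon as every branch ends in a multiple of `φ`: the weights of the branches
add up to one because total probability is preserved. -/
lemma convertible_of_branches {ψ φ : SharedState V} {S : V → QSystem}
    (hψ : ψ.density.trace = 1) (hφ : φ.density.trace = 1) (m : V → ℕ)
    (K : ∀ v, Fin (m v) → Matrix (S v).Basis (ψ.sys v).Basis ℂ)
    (hK : ∀ v, ∑ a, (K v a)ᴴ * K v a = 1)
    (U : (∀ v, Fin (m v)) → ∀ v, Matrix (φ.sys v).Basis (S v).Basis ℂ)
    (hU : ∀ a v, (U a v)ᴴ * U a v = 1)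
    (h : ∀ a, ∃ c : ℂ,
      tensorOp (U a) *ᵥ (tensorOp (fun v => K v (a v)) *ᵥ ψ.amp) = c • φ.amp) :
    Convertible ψ φ := by
  choose c hc using h
  let P : Protocol ψ.sys φ.sys := .round m K hK fun a =>
    .round (fun _ => 1) (fun v _ => U a v) (fun v => by simp [hU]) fun _ => .done _
  have hP : P.run ψ.density = (∑ a, c a * star (c a)) • φ.density := by
    simp only [P, Protocol.run, SharedState.density, mul_vecMulVec_mul_conjTranspose, hc,
      Finset.sum_smul]
    refine Finset.sum_congr rfl fun a _ => ?_
    rw [Fintype.sum_unique]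
    ext x y
    simp only [Matrix.vecMulVec_apply, Matrix.smul_apply, Pi.star_apply, Pi.smul_apply,
      smul_eq_mul, star_mul']
    ring
  have htr := P.trace_run ψ.density
  rw [hP, Matrix.trace_smul, hφ, hψ, smul_eq_mul, mul_one] at htr
  exact ⟨P, by rw [hP, htr, one_smul]⟩

end Protocols

section States

/-! ### Amplitudes of CAT states and hypergraph states -/

section CatAmp

variable {α : Type} [Fintype α]

lemma sqrt_two_mul_self : ((Real.sqrt 2 : ℝ) : ℂ) * (Real.sqrt 2 : ℝ) = 2 := by
  rw [← Complex.ofReal_mul, Real.mul_self_sqrt (by norm_num)]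
  norm_num

lemma sqrt_two_ne_zero : ((Real.sqrt 2 : ℝ) : ℂ) ≠ 0 := by
  intro h
  have := sqrt_two_mul_self
  simp [h] at this

/-- The squared modulus of the amplitude `1 / √2`. -/
lemma star_inv_sqrt_two_mul_self :
    star ((Real.sqrt 2 : ℝ) : ℂ)⁻¹ * ((Real.sqrt 2 : ℝ) : ℂ)⁻¹ = 1 / 2 := by
  rw [star_inv₀, show star ((Real.sqrt 2 : ℝ) : ℂ) = (Real.sqrt 2 : ℝ) from
    Complex.conj_ofReal _, ← mul_inv, sqrt_two_mul_self, one_div]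

lemma catAmp_of_eq_const [Nonempty α] {y : α → Fin 2} {b : Fin 2} (h : ∀ u, y u = b) :
    catAmp y = ((Real.sqrt 2 : ℝ) : ℂ)⁻¹ := by
  simp only [catAmp, h, forall_const]
  fin_cases b <;> simp

lemma catAmp_eq_zero_of_ne {y : α → Fin 2} {u w : α} (h : y u ≠ y w) : catAmp y = 0 := by
  rw [catAmp, if_neg fun h' => h ((h' u).trans (h' w).symm),
    if_neg fun h' => h ((h' u).trans (h' w).symm)]
  simp

/-- Flipping all qubits fixes the CAT state. -/
lemma catAmp_add_const (y : α → Fin 2) (s : Fin 2) : catAmp (fun u => y u + s) = catAmp y := by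
  fin_cases s
  · simp
  · have h (b : Fin 2) : (b + 1 = 0 ↔ b = 1) ∧ (b + 1 = 1 ↔ b = 0) := by
      fin_cases b <;> decide
    simp only [catAmp, Fin.mk_one, (h _).1, (h _).2]
    rw [add_comm]

lemma sum_catAmp_mul_star [DecidableEq α] [Nonempty α] :
    ∑ y : α → Fin 2, catAmp y * star (catAmp y) = 1 := by
  have h (y : α → Fin 2) : catAmp y * star (catAmp y) =
      (if y = fun _ => 0 then 1 / 2 else 0) + if y = fun _ => 1 then 1 / 2 else 0 := by
    have h01 : (fun _ : α => (0 : Fin 2)) ≠ fun _ => 1 := fun h' => by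
      simpa using congrFun h' (Classical.arbitrary α)
    by_cases h0 : y = fun _ => 0
    · rw [if_pos h0, if_neg (h0 ▸ h01), catAmp_of_eq_const (congrFun h0), mul_comm,
        star_inv_sqrt_two_mul_self, add_zero]
    by_cases h1 : y = fun _ => 1
    · rw [if_neg h0, if_pos h1, catAmp_of_eq_const (congrFun h1), mul_comm,
        star_inv_sqrt_two_mul_self, zero_add]
    · rw [catAmp, if_neg fun h => h0 (funext h), if_neg fun h => h1 (funext h), if_neg h0,
        if_neg h1]
      simp
  simp only [h, Finset.sum_add_distrib, Finset.sum_ite_eq', Finset.mem_univ, if_true]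
  norm_num

end CatAmp

variable {V : Type} [DecidableEq V]

lemma hypergraphState_unit_amp (S : Finset V) (x : ∀ v, {_k : Unit // v ∈ S} → Fin 2) :
    (hypergraphState fun _ : Unit => S).amp x =
      catAmp fun u : {u : V // u ∈ S} => x u.1 ⟨(), u.2⟩ :=
  Fintype.prod_unique fun k : Unit => catAmp fun u : {u : V // u ∈ S} => x u.1 ⟨k, u.2⟩

variable [Fintype V]

/-- The joint state of nonempty hyperedges is a unit vector, the norm of a tensor product being
multiplicative. -/
lemma trace_density_hypergraphState {κ : Type} [Fintype κ] [DecidableEq κ] (E : κ → Finset V)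
    (hE : ∀ k, (E k).Nonempty) : (hypergraphState E).density.trace = 1 := by
  let e : (∀ v, {k : κ // v ∈ E k} → Fin 2) ≃ (∀ k, {u : V // u ∈ E k} → Fin 2) :=
    { toFun x k u := x u.1 ⟨k, u.2⟩
      invFun y v k := y k.1 ⟨v, k.2⟩
      left_inv _ := rfl
      right_inv _ := rfl }
  have (k : κ) : Nonempty {u : V // u ∈ E k} := (hE k).to_subtype
  calc (hypergraphState E).density.trace
      = ∑ x : ∀ v, {k : κ // v ∈ E k} → Fin 2,
          ∏ k, catAmp (e x k) * star (catAmp (e x k)) := by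
        refine Finset.sum_congr rfl fun x _ => ?_
        rw [Finset.prod_mul_distrib, ← star_prod]
        rfl
    _ = ∑ y : ∀ k, {u : V // u ∈ E k} → Fin 2, ∏ k, catAmp (y k) * star (catAmp (y k)) :=
        e.sum_comp fun y => ∏ k, catAmp (y k) * star (catAmp (y k))
    _ = ∏ k, ∑ y : {u : V // u ∈ E k} → Fin 2, catAmp y * star (catAmp y) := by
        rw [Finset.prod_univ_sum, Fintype.piFinset_univ]
    _ = 1 := Finset.prod_eq_one fun k _ => sum_catAmp_mul_star

lemma catState_amp_eq_catAmp (x : ∀ v, {_k : Unit // v ∈ Finset.univ} → Fin 2) :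
    (catState V).amp x = catAmp fun v => x v ⟨(), Finset.mem_univ v⟩ := by
  have h (b : Fin 2) : (∀ u : {u : V // u ∈ Finset.univ}, x u.1 ⟨(), u.2⟩ = b) ↔
      ∀ v, x v ⟨(), Finset.mem_univ v⟩ = b :=
    ⟨fun h v => h ⟨v, Finset.mem_univ v⟩, fun h u => h u.1⟩
  refine (hypergraphState_unit_amp Finset.univ x).trans ?_
  simp only [catAmp, h]

/-- The joint basis state `|b…b⟩` of `n` qubits. -/
def catBasis (V : Type) [Fintype V] [DecidableEq V] (b : Fin 2) : JointBasis (catState V).sys :=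
  fun _ _ => b

lemma catState_amp (y : JointBasis (catState V).sys) :
    (catState V).amp y = ((if y = catBasis V 0 then 1 else 0) +
      if y = catBasis V 1 then 1 else 0) / (Real.sqrt 2 : ℂ) := by
  have h (b : Fin 2) : (∀ v, y v ⟨(), Finset.mem_univ v⟩ = b) ↔ y = catBasis V b :=
    ⟨fun h => funext fun v => funext fun _ => h v, fun h _ => h ▸ rfl⟩
  refine (catState_amp_eq_catAmp y).trans ?_
  simp only [catAmp, h]

/-- A product operator turns the CAT state into a sum of two product vectors. -/
lemma tensorOp_mulVec_catState {S : V → QSystem}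
    (L : ∀ v, Matrix (S v).Basis ((catState V).sys v).Basis ℂ) (x : JointBasis S) :
    (tensorOp L *ᵥ (catState V).amp) x =
      (∏ v, L v (x v) (catBasis V 0 v) + ∏ v, L v (x v) (catBasis V 1 v)) /
        (Real.sqrt 2 : ℂ) := by
  simp only [Matrix.mulVec, dotProduct, catState_amp, tensorOp, Matrix.of_apply, mul_div_assoc',
    mul_add, mul_ite, mul_one, mul_zero, ← Finset.sum_div, Finset.sum_add_distrib,
    Finset.sum_ite_eq', Finset.mem_univ, if_true]

/-! ### From the CAT state to smaller CAT states -/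

/-- The parties outside `S` measure in the basis `(|0⟩ ± |1⟩) / √2`, which leaves a CAT state on
`S` up to a sign, the product of the outcomes; one party in `S` corrects that sign. -/
lemma convertible_catState_restrict (S : Finset V) (hS : S.Nonempty) :
    Convertible (catState V) (hypergraphState fun _ : Unit => S) := by
  obtain ⟨i, hi⟩ := hS
  -- The parties in `S` also announce an outcome, a coin toss that is ignored.
  let K (v : V) (a : Fin 2) :
      Matrix ({_k : Unit // v ∈ S} → Fin 2) ({_k : Unit // v ∈ Finset.univ} → Fin 2) ℂ :=
    Matrix.of fun x y => (Real.sqrt 2 : ℂ)⁻¹ *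
      if h : v ∈ S then (if x ⟨(), h⟩ = y ⟨(), Finset.mem_univ v⟩ then 1 else 0)
      else (-1) ^ (a.val * (y ⟨(), Finset.mem_univ v⟩).val)
  let s (a : V → Fin 2) : ℂ := ∏ v, if v ∈ S then 1 else (-1) ^ (a v).val
  have hs (a : V → Fin 2) : s a = 1 ∨ s a = -1 := by
    refine Finset.prod_induction _ (fun z : ℂ => z = 1 ∨ z = -1) ?_ (Or.inl rfl) fun v _ => ?_
    · rintro _ _ (rfl | rfl) (rfl | rfl) <;> simp
    · split_ifs
      · exact Or.inl rfl
      · exact neg_one_pow_eq_or ℂ _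
  let c (a : V → Fin 2) (v : V) (x : {_k : Unit // v ∈ S} → Fin 2) : ℂ :=
    if h : v ∈ S then (if v = i then s a ^ (x ⟨(), h⟩).val else 1) else 1
  have hK (v : V) : ∑ a, (K v a)ᴴ * K v a = 1 := by
    let p : {_k : Unit // v ∈ Finset.univ} := ⟨(), Finset.mem_univ v⟩
    by_cases hv : v ∈ S
    · let f : ({_k : Unit // v ∈ S} → Fin 2) ≃ ({_k : Unit // v ∈ Finset.univ} → Fin 2) :=
        { toFun x _ := x ⟨(), hv⟩
          invFun y _ := y p
          left_inv _ := rfl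
          right_inv _ := rfl }
      have hf (a : Fin 2) : K v a = monomialMatrix (fun _ => (Real.sqrt 2 : ℂ)⁻¹) f := by
        ext x y
        have : x ⟨(), hv⟩ = y p ↔ y = f x :=
          ⟨fun h => funext fun _ => h.symm, fun h => h ▸ rfl⟩
        simp only [K, monomialMatrix, Matrix.of_apply, dif_pos hv, ← this, mul_ite, mul_one,
          mul_zero, p]
      simp only [hf, monomialMatrix_equiv_conjTranspose_mul_self _ f
        fun _ => star_inv_sqrt_two_mul_self]
      rw [Fin.sum_univ_two, ← add_smul, add_halves, one_smul]
    · have : IsEmpty {_k : Unit // v ∈ S} := ⟨fun k => hv k.2⟩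
      ext y y'
      have hy : y = y' ↔ y p = y' p := ⟨fun h => h ▸ rfl, fun h => funext fun _ => h⟩
      have h (a : Fin 2) : ((K v a)ᴴ * K v a) y y' =
          1 / 2 * ((-1) ^ (a.val * (y p).val) * (-1) ^ (a.val * (y' p).val)) := by
        rw [Matrix.mul_apply, Fintype.sum_unique, Matrix.conjTranspose_apply,
          ← star_inv_sqrt_two_mul_self]
        simp only [K, Matrix.of_apply, dif_neg hv, star_mul', star_pow, star_neg, star_one, p]
        ring
      rw [Matrix.sum_apply, Finset.sum_congr rfl fun a _ => h a, Fin.sum_univ_two,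
        Matrix.one_apply]
      simp only [hy]
      generalize y p = b
      generalize y' p = b'
      fin_cases b <;> fin_cases b' <;> norm_num
  have hU (a : V → Fin 2) (v : V) :
      (monomialMatrix (c a v) id)ᴴ * monomialMatrix (c a v) id = 1 := by
    rw [← one_smul ℂ 1]
    refine monomialMatrix_equiv_conjTranspose_mul_self (c a v) (Equiv.refl _) fun x => ?_
    have hc : c a v x = 1 ∨ c a v x = -1 := by
      simp only [c]
      split_ifs
      · rcases hs a with h | h <;> rw [h]
        · exact Or.inl (one_pow _)
        · exact neg_one_pow_eq_or ℂ _
      · exact Or.inl rfl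
      · exact Or.inl rfl
    rcases hc with h | h <;> rw [h] <;> simp
  have hprod (a : V → Fin 2) (x : ∀ v, {_k : Unit // v ∈ S} → Fin 2) (b : Fin 2) :
      ∏ v, K v (a v) (x v) (fun _ => b) = (Real.sqrt 2 : ℂ)⁻¹ ^ Fintype.card V *
        if ∀ u : {u : V // u ∈ S}, x u.1 ⟨(), u.2⟩ = b then s a ^ b.val else 0 := by
    simp only [K, Matrix.of_apply, Finset.prod_mul_distrib, Finset.prod_const, Finset.card_univ]
    congr 1
    split_ifs with h
    · simp only [s, ← Finset.prod_pow]
      refine Finset.prod_congr rfl fun v _ => ?_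
      by_cases hv : v ∈ S
      · rw [dif_pos hv, if_pos hv, one_pow, if_pos (h ⟨v, hv⟩)]
      · rw [dif_neg hv, if_neg hv, pow_mul]
    · obtain ⟨u, hu⟩ := not_forall.1 h
      exact Finset.prod_eq_zero (Finset.mem_univ u.1) (by rw [dif_pos u.2, if_neg hu])
  have hphase (a : V → Fin 2) (x : ∀ v, {_k : Unit // v ∈ S} → Fin 2) :
      ∏ v, c a v (x v) = s a ^ (x i ⟨(), hi⟩).val := by
    rw [Finset.prod_eq_single i (fun v _ hv => by simp [c, hv]) (by simp)]
    simp [c, hi]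
  have key (a : V → Fin 2) (x : ∀ v, {_k : Unit // v ∈ S} → Fin 2) :
      (∏ v, c a v (x v)) * ((∏ v, K v (a v) (x v) (fun _ => 0) +
        ∏ v, K v (a v) (x v) (fun _ => 1)) / (Real.sqrt 2 : ℂ)) =
      (Real.sqrt 2 : ℂ)⁻¹ ^ Fintype.card V * (hypergraphState fun _ : Unit => S).amp x := by
    rw [hphase, hprod, hprod, hypergraphState_unit_amp, catAmp]
    have hss : s a * s a = 1 := by rcases hs a with h | h <;> rw [h] <;> norm_num
    by_cases h0 : ∀ u : {u : V // u ∈ S}, x u.1 ⟨(), u.2⟩ = 0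
    · have hi0 := h0 ⟨i, hi⟩
      have h1 : ¬ ∀ u : {u : V // u ∈ S}, x u.1 ⟨(), u.2⟩ = 1 := fun h => by
        simpa using hi0.symm.trans (h ⟨i, hi⟩)
      rw [if_pos h0, if_pos h0, if_neg h1, if_neg h1, hi0]
      simp [div_eq_mul_inv]
    by_cases h1 : ∀ u : {u : V // u ∈ S}, x u.1 ⟨(), u.2⟩ = 1
    · have hi1 := h1 ⟨i, hi⟩
      rw [if_neg h0, if_neg h0, if_pos h1, if_pos h1, hi1]
      simp only [Fin.val_one, pow_one, mul_zero, zero_add]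
      linear_combination (Real.sqrt 2 : ℂ)⁻¹ ^ Fintype.card V * (Real.sqrt 2 : ℂ)⁻¹ * hss
    · rw [if_neg h0, if_neg h0, if_neg h1, if_neg h1]
      simp
  let R : SharedState V := hypergraphState fun _ : Unit => S
  have hbranch (a : V → Fin 2) (x : JointBasis R.sys) :
      (tensorOp (S := R.sys) (S' := R.sys) (fun v => monomialMatrix (c a v) id) *ᵥ
        (tensorOp (S' := R.sys) (fun v => K v (a v)) *ᵥ (catState V).amp)) x =
      ((Real.sqrt 2 : ℂ)⁻¹ ^ Fintype.card V • R.amp) x := by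
    have h1 := tensorOp_monomialMatrix_mulVec (S := R.sys) (S' := R.sys) (c a) (fun _ => id)
      (tensorOp (S' := R.sys) (fun v => K v (a v)) *ᵥ (catState V).amp) x
    have h2 := tensorOp_mulVec_catState (S := R.sys) (fun v => K v (a v)) x
    refine h1.trans ?_
    simp only [id]
    rw [h2]
    exact key a x
  have h1 : R.density.trace = 1 := trace_density_hypergraphState _ fun _ => ⟨i, hi⟩
  have h2 : (catState V).density.trace = 1 :=
    trace_density_hypergraphState _ fun _ => ⟨i, Finset.mem_univ i⟩
  exact convertible_of_branches (S := R.sys) h2 h1 (fun _ => 2) K hK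
    (fun a v => monomialMatrix (c a v) id) hU fun a => ⟨_, funext (hbranch a)⟩

end States

section TreeToCat

variable {V : Type} [Fintype V] [DecidableEq V]

/-! ### From spanning EPR trees to the CAT state -/

/-- On a tree, every antisymmetric function on the oriented edges is the difference of a function
on the vertices: sum it along the paths from a root. -/
lemma exists_potential_of_isTree {V A : Type*} [AddCommGroup A] {G : SimpleGraph V}
    (hG : G.IsTree) (d : V → V → A) (hd : ∀ u v, d v u = -d u v) :
    ∃ t : V → A, ∀ u v, G.Adj u v → t v - t u = d u v := by
  obtain ⟨r⟩ := hG.connected.nonempty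
  choose p hp _ using hG.existsUnique_path r
  let t (v : V) : A := ((p v).darts.map fun e => d e.fst e.snd).sum
  have key (u v : V) (h : G.Adj u v) (hu : u ∈ (p v).support) : t v - t u = d u v := by
    simp [t, hG.isAcyclic.path_concat (hp u) (hp v) h hu, SimpleGraph.Walk.darts_concat]
  refine ⟨t, fun u v h => ?_⟩
  by_cases hu : u ∈ (p v).support
  · exact key u v h hu
  · have hv := hG.isAcyclic.mem_support_of_ne_mem_support_of_adj_of_isPath (hp u) (hp v) h hu
    rw [← neg_sub, key v u h.symm hv, ← hd]

lemma prod_catAmp_of_connected {G : SimpleGraph V} [DecidableRel G.Adj] (hG : G.Connected)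
    (X : V → Fin 2) :
    ∏ e : G.edgeSet, catAmp (fun u : {u : V // u ∈ e.1.toFinset} => X u.1) =
      (Real.sqrt 2 : ℂ)⁻¹ ^ Fintype.card G.edgeSet * (Real.sqrt 2 : ℂ) *
        catAmp X := by
  obtain ⟨r⟩ := hG.nonempty
  have : Nonempty V := ⟨r⟩
  have (e : G.edgeSet) : Nonempty {u : V // u ∈ e.1.toFinset} :=
    (Finset.nonempty_iff_ne_empty.2 e.1.toFinset_ne_empty).to_subtype
  by_cases h : ∀ u v, G.Adj u v → X u = X v
  · have hX (v : V) : X v = X r := by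
      obtain ⟨w⟩ := hG.preconnected v r
      induction w with
      | nil => rfl
      | cons hadj _ ih => exact (h _ _ hadj).trans ih
    rw [catAmp_of_eq_const hX, mul_assoc, mul_inv_cancel₀ sqrt_two_ne_zero, mul_one,
      Finset.prod_congr rfl fun e _ => catAmp_of_eq_const
        (y := fun u : {u : V // u ∈ e.1.toFinset} => X u.1) fun u => hX u.1, Finset.prod_const,
      Finset.card_univ]
  · push Not at h
    obtain ⟨u, v, hadj, hne⟩ := h
    rw [catAmp_eq_zero_of_ne hne, mul_zero]
    exact Finset.prod_eq_zero (Finset.mem_univ ⟨s(u, v), hadj⟩)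
      (catAmp_eq_zero_of_ne (u := ⟨u, by simp⟩) (w := ⟨v, by simp⟩) hne)

/-- Party `v` measures which coset of the diagonal the string of her qubits lies in and keeps one
qubit `x` for the position in the coset: outcome `b` means that her string is `b + (x, …, x)`. On
every edge, the two kept qubits then differ by a known bit, and since the graph is a tree, these
bits are the differences of a function on the parties, by which they shift their qubits. -/
lemma convertible_eprGraph_catState {T : SimpleGraph V} [DecidableRel T.Adj] (hT : T.IsTree) :
    Convertible (eprGraph T) (catState V) := by
  let B (v : V) : Type := {e : T.edgeSet // v ∈ e.1.toFinset} → Fin 2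
  let C (v : V) : Type := {_k : Unit // v ∈ Finset.univ} → Fin 2
  let _ (v : V) : Fintype (B v) := inferInstanceAs (Fintype (_ → Fin 2))
  let _ (v : V) : DecidableEq (B v) := inferInstanceAs (DecidableEq (_ → Fin 2))
  let _ (v : V) : Fintype (C v) := inferInstanceAs (Fintype (_ → Fin 2))
  let _ (v : V) : DecidableEq (C v) := inferInstanceAs (DecidableEq (_ → Fin 2))
  let p (v : V) : {_k : Unit // v ∈ Finset.univ} := ⟨(), Finset.mem_univ v⟩
  let f (v : V) (b : B v) (x : C v) : B v := fun e => b e + x (p v)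
  let dec (v : V) : Fin (Fintype.card (B v)) ≃ B v := (Fintype.equivFin (B v)).symm
  -- Every string arises from two pairs `(b, x)`, hence the normalization.
  let K (v : V) (a : Fin (Fintype.card (B v))) : Matrix (C v) (B v) ℂ :=
    monomialMatrix (fun _ => (Real.sqrt 2 : ℂ)⁻¹) (f v (dec v a))
  have hK (v : V) : ∑ a, (K v a)ᴴ * K v a = 1 := by
    have hcard : Fintype.card (C v) = 2 := by
      refine (Fintype.card_fun).trans ?_
      simp
    simp only [K, monomialMatrix_conjTranspose_mul_self, star_inv_sqrt_two_mul_self]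
    rw [(dec v).sum_comp fun b => Matrix.diagonal fun y => ∑ x, if y = f v b x then (1 / 2 : ℂ)
      else 0]
    ext y y'
    rw [Matrix.sum_apply]
    simp only [Matrix.diagonal_apply, Matrix.one_apply]
    split_ifs
    · have hf (b : B v) (x : C v) : y = f v b x ↔ b = fun e => y e - x (p v) :=
        ⟨fun h => funext fun e => eq_sub_of_add_eq (congrFun h e).symm,
          fun h => funext fun e => by rw [h]; exact (sub_add_cancel _ _).symm⟩
      rw [Finset.sum_comm]
      simp only [hf, Finset.sum_ite_eq', Finset.mem_univ, if_true, Finset.sum_const,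
        Finset.card_univ, hcard]
      norm_num
    · simp
  have hpot (b : ∀ v, B v) : ∃ t : V → Fin 2, ∀ (e : T.edgeSet) (u v : V)
      (hu : u ∈ e.1.toFinset) (hv : v ∈ e.1.toFinset),
      b u ⟨e, hu⟩ + t u = b v ⟨e, hv⟩ + t v := by
    -- Extension by zero, which avoids transporting membership proofs along `s(u, v) = s(v, u)`.
    let b' (v : V) (e : Sym2 V) : Fin 2 :=
      if h : e ∈ T.edgeSet ∧ v ∈ e.toFinset then b v ⟨⟨e, h.1⟩, h.2⟩ else 0
    have hb' (v : V) (e : T.edgeSet) (h : v ∈ e.1.toFinset) : b v ⟨e, h⟩ = b' v e.1 := by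
      simp only [b']
      rw [dif_pos ⟨e.2, h⟩]
    obtain ⟨t, ht⟩ := exists_potential_of_isTree hT (fun u v => b' u s(u, v) - b' v s(u, v))
      fun u v => by rw [Sym2.eq_swap, neg_sub]
    refine ⟨t, fun e u v hu hv => ?_⟩
    rw [hb', hb']
    by_cases huv : u = v
    · rw [huv]
    · have he : e.1 = s(u, v) :=
        (Sym2.mem_and_mem_iff huv).1 ⟨Sym2.mem_toFinset.1 hu, Sym2.mem_toFinset.1 hv⟩
      have hadj : T.Adj u v := by
        rw [← SimpleGraph.mem_edgeSet, ← he]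
        exact e.2
      rw [he, add_comm (b' v _)]
      exact (sub_eq_sub_iff_add_eq_add.1 (ht u v hadj)).symm
  choose t ht using hpot
  let U (a : ∀ v, Fin (Fintype.card (B v))) (v : V) : Matrix (C v) (C v) ℂ :=
    monomialMatrix (fun _ => 1) fun x k => x k + t (fun v => dec v (a v)) v
  have hU (a : ∀ v, Fin (Fintype.card (B v))) (v : V) : (U a v)ᴴ * U a v = 1 := by
    rw [← one_smul ℂ 1]
    exact monomialMatrix_equiv_conjTranspose_mul_self _
      (Equiv.addRight (fun _ => t (fun v => dec v (a v)) v :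
        {_k : Unit // v ∈ Finset.univ} → Fin 2)) fun _ => by simp
  have key (b : ∀ v, B v) (x : ∀ v, C v) :
      (eprGraph T).amp (fun v => f v (b v) fun k => x v k + t b v) =
        (Real.sqrt 2 : ℂ)⁻¹ ^ Fintype.card T.edgeSet * (Real.sqrt 2 : ℂ) *
          (catState V).amp x := by
    refine Eq.trans ?_ ((prod_catAmp_of_connected hT.connected fun v => x v (p v)).trans
      (congrArg _ (catState_amp_eq_catAmp x).symm))
    refine Finset.prod_congr rfl fun e _ => ?_
    obtain ⟨w, hw⟩ := Finset.nonempty_iff_ne_empty.2 e.1.toFinset_ne_empty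
    refine Eq.trans ?_ (catAmp_add_const _ (b w ⟨e, hw⟩ + t b w))
    congr 1
    funext u
    change b u.1 ⟨e, u.2⟩ + (x u.1 (p u.1) + t b u.1) =
      x u.1 (p u.1) + (b w ⟨e, hw⟩ + t b w)
    rw [ht b e w u.1 hw u.2]
    abel
  have hbranch (a : ∀ v, Fin (Fintype.card (B v))) (x : JointBasis (catState V).sys) :
      (tensorOp (S := (catState V).sys) (S' := (catState V).sys) (U a) *ᵥ
        (tensorOp (S := (eprGraph T).sys) (S' := (catState V).sys) (fun v => K v (a v)) *ᵥ
          (eprGraph T).amp)) x =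
      (((∏ _v : V, (Real.sqrt 2 : ℂ)⁻¹) * ((Real.sqrt 2 : ℂ)⁻¹ ^ Fintype.card T.edgeSet *
        (Real.sqrt 2 : ℂ))) • (catState V).amp) x := by
    have h1 := tensorOp_monomialMatrix_mulVec (S := (catState V).sys) (S' := (catState V).sys)
      (fun _ _ => 1) (fun v x k => x k + t (fun v => dec v (a v)) v)
      (tensorOp (S := (eprGraph T).sys) (S' := (catState V).sys) (fun v => K v (a v)) *ᵥ
          (eprGraph T).amp) x
    have h2 := tensorOp_monomialMatrix_mulVec (S := (eprGraph T).sys) (S' := (catState V).sys)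
      (fun _ _ => (Real.sqrt 2 : ℂ)⁻¹) (fun v => f v (dec v (a v))) (eprGraph T).amp
      (fun v k => x v k + t (fun v => dec v (a v)) v)
    refine h1.trans ?_
    rw [Finset.prod_const_one, one_mul]
    refine h2.trans ?_
    rw [Pi.smul_apply, smul_eq_mul, mul_assoc]
    exact congrArg _ (key (fun v => dec v (a v)) x)
  obtain ⟨r⟩ := hT.connected.nonempty
  have h1 : (eprGraph T).density.trace = 1 := trace_density_hypergraphState _ fun e =>
    Finset.nonempty_iff_ne_empty.2 e.1.toFinset_ne_empty
  have h2 : (catState V).density.trace = 1 :=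
    trace_density_hypergraphState _ fun _ => ⟨r, Finset.mem_univ r⟩
  exact convertible_of_branches (S := (catState V).sys) h1 h2 _ K hK U hU
    fun a => ⟨_, funext (hbranch a)⟩

end TreeToCat

section Impossibility

/-! ### Impossible conversions -/

lemma exists_one_lt_degree_of_isTree {V : Type*} [Fintype V] {T : SimpleGraph V}
    [DecidableRel T.Adj] (hT : T.IsTree)
    (hV : 3 ≤ Fintype.card V) : ∃ v, 1 < T.degree v := by
  by_contra! h
  have h1 : ∑ v, T.degree v ≤ ∑ _v : V, 1 := Finset.sum_le_sum fun v _ => h v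
  rw [T.sum_degrees_eq_twice_card_edges, Finset.sum_const, Finset.card_univ] at h1
  have h2 := hT.card_edgeFinset
  simp only [smul_eq_mul, mul_one] at h1
  omega

variable {V : Type} [Fintype V] [DecidableEq V]

/-- If party `w` starts with a trivial system, a product operator leaves her uncorrelated with the
others, so that the amplitudes factor and her index can be exchanged between two of them. -/
lemma tensorOp_mulVec_exchange {S S' : V → QSystem} {w : V} [Unique (S w).Basis]
    (L : ∀ v, Matrix (S' v).Basis (S v).Basis ℂ) (ψ : JointBasis S → ℂ) (x x' : JointBasis S') :
    (tensorOp L *ᵥ ψ) x * (tensorOp L *ᵥ ψ) x' =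
      (tensorOp L *ᵥ ψ) (Function.update x w (x' w)) *
        (tensorOp L *ᵥ ψ) (Function.update x' w (x w)) := by
  let g (x : JointBasis S') : ℂ := ∑ y, (∏ v ∈ Finset.univ.erase w, L v (x v) (y v)) * ψ y
  have hg (x : JointBasis S') : (tensorOp L *ᵥ ψ) x = L w (x w) default * g x := by
    simp only [Matrix.mulVec, dotProduct, tensorOp, Matrix.of_apply, g, Finset.mul_sum]
    refine Finset.sum_congr rfl fun y _ => ?_
    rw [← Finset.mul_prod_erase _ _ (Finset.mem_univ w), Unique.eq_default (y w), mul_assoc]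
  have hup (x : JointBasis S') (z : (S' w).Basis) : g (Function.update x w z) = g x := by
    refine Finset.sum_congr rfl fun y _ => ?_
    congr 1
    refine Finset.prod_congr rfl fun v hv => ?_
    rw [Function.update_of_ne (Finset.ne_of_mem_erase hv)]
  simp only [hg, hup, Function.update_self]
  ring

lemma catState_amp_catBasis [Nonempty V] (b : Fin 2) :
    (catState V).amp (catBasis V b) = (Real.sqrt 2 : ℂ)⁻¹ :=
  (catState_amp_eq_catAmp _).trans (catAmp_of_eq_const (b := b) fun _ => rfl)

/-- A CAT state of some of the parties cannot be converted to the CAT state of all of them. -/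
lemma not_convertible_catState [Nontrivial V] {S : Finset V} {w : V} (hw : w ∉ S) :
    ¬ Convertible (hypergraphState fun _ : Unit => S) (catState V) := by
  intro h
  have hne : (catState V).amp ≠ 0 := fun h0 =>
    inv_ne_zero sqrt_two_ne_zero ((catState_amp_catBasis 0).symm.trans (congrFun h0 _))
  obtain ⟨L, c, hc, hL⟩ := h.exists_tensorOp hne
  have : IsEmpty {_k : Unit // w ∈ S} := ⟨fun k => hw k.2⟩
  let _ : Unique ((hypergraphState fun _ : Unit => S).sys w).Basis :=
    inferInstanceAs (Unique ({_k : Unit // w ∈ S} → Fin 2))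
  obtain ⟨u, hu⟩ := exists_ne w
  have hx := tensorOp_mulVec_exchange (w := w) L (hypergraphState fun _ : Unit => S).amp
    (catBasis V 0) (catBasis V 1)
  have h0 : (catState V).amp (Function.update (catBasis V 0) w (catBasis V 1 w)) = 0 := by
    refine (catState_amp_eq_catAmp _).trans (catAmp_eq_zero_of_ne (u := w) (w := u) ?_)
    simp only [Function.update_self, Function.update_of_ne hu]
    exact one_ne_zero
  simp only [hL, Pi.smul_apply, smul_eq_mul, h0, catState_amp_catBasis, mul_zero, zero_mul] at hx
  exact mul_ne_zero (mul_ne_zero hc (inv_ne_zero sqrt_two_ne_zero))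
    (mul_ne_zero hc (inv_ne_zero sqrt_two_ne_zero)) hx

/-- The CAT state has Schmidt rank two between a party `v` and the others, and product operators
do not increase it. A hypergraph state in which `v` shares two hyperedges with others has a greater
Schmidt rank: its matrix of amplitudes contains the identity matrix of size three. -/
lemma not_convertible_hypergraphState {κ : Type} [Fintype κ] [DecidableEq κ] {E : κ → Finset V}
    (hE : ∀ k, (E k).Nonempty) {v : V} {k₁ k₂ : κ} (hk : k₁ ≠ k₂)
    (h₁ : v ∈ E k₁ ∧ ∃ u ∈ E k₁, u ≠ v) (h₂ : v ∈ E k₂ ∧ ∃ u ∈ E k₂, u ≠ v) :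
    ¬ Convertible (catState V) (hypergraphState E) := by
  intro h
  -- `v` reads the string `s` off her qubits, the other parties read `t`.
  let X (s t : κ → Fin 2) : JointBasis (hypergraphState E).sys :=
    fun u k => if u = v then s k.1 else t k.1
  have hamp (s t : κ → Fin 2) : (hypergraphState E).amp (X s t) =
      ∏ k, catAmp fun u : {u : V // u ∈ E k} => if u.1 = v then s k else t k := rfl
  have hdiag (s : κ → Fin 2) :
      (hypergraphState E).amp (X s s) = (Real.sqrt 2 : ℂ)⁻¹ ^ Fintype.card κ := by
    rw [hamp, ← Finset.card_univ, ← Finset.prod_const]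
    refine Finset.prod_congr rfl fun k _ => ?_
    have : Nonempty {u : V // u ∈ E k} := (hE k).to_subtype
    exact catAmp_of_eq_const fun u => ite_self _
  have hoff {s t : κ → Fin 2} {k : κ} (hk : v ∈ E k ∧ ∃ u ∈ E k, u ≠ v) (hst : s k ≠ t k) :
      (hypergraphState E).amp (X s t) = 0 := by
    obtain ⟨hv, u, hu, huv⟩ := hk
    rw [hamp]
    refine Finset.prod_eq_zero (Finset.mem_univ k)
      (catAmp_eq_zero_of_ne (u := ⟨v, hv⟩) (w := ⟨u, hu⟩) ?_)
    rwa [if_pos rfl, if_neg huv]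
  have hκ : (Real.sqrt 2 : ℂ)⁻¹ ^ Fintype.card κ ≠ 0 := pow_ne_zero _ (inv_ne_zero sqrt_two_ne_zero)
  obtain ⟨L, c, hc, hL⟩ := h.exists_tensorOp fun h0 =>
    hκ ((hdiag 0).symm.trans (congrFun h0 _))
  let P (b : Fin 2) (s : κ → Fin 2) : ℂ := L v (fun k => s k.1) (catBasis V b v)
  let Q (b : Fin 2) (t : κ → Fin 2) : ℂ :=
    ∏ u ∈ Finset.univ.erase v, L u (fun k => t k.1) (catBasis V b u)
  have hPQ (s t : κ → Fin 2) :
      (P 0 s * Q 0 t + P 1 s * Q 1 t) / (Real.sqrt 2 : ℂ) =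
        c * (hypergraphState E).amp (X s t) := by
    have hsplit (b : Fin 2) : ∏ u, L u (X s t u) (catBasis V b u) = P b s * Q b t := by
      rw [← Finset.mul_prod_erase _ _ (Finset.mem_univ v)]
      congr 1
      · exact congrArg (fun z => L v z (catBasis V b v)) (funext fun k => if_pos rfl)
      · refine Finset.prod_congr rfl fun u hu => ?_
        exact congrArg (fun z => L u z (catBasis V b u))
          (funext fun k => if_neg (Finset.ne_of_mem_erase hu))
    rw [← hsplit, ← hsplit, ← tensorOp_mulVec_catState, hL, Pi.smul_apply, smul_eq_mul]
  let s : Fin 3 → κ → Fin 2 := ![0, Pi.single k₁ 1, Pi.single k₂ 1]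
  let M : Matrix (Fin 3) (Fin 3) ℂ :=
    Matrix.of fun i j => c * (hypergraphState E).amp (X (s i) (s j))
  have hM : M = Matrix.diagonal fun _ => c * (Real.sqrt 2 : ℂ)⁻¹ ^ Fintype.card κ := by
    have hs (i j : Fin 3) (hij : i ≠ j) : s i k₁ ≠ s j k₁ ∨ s i k₂ ≠ s j k₂ := by
      fin_cases i <;> fin_cases j <;> simp_all [s, hk.symm]
    ext i j
    by_cases hij : i = j
    · subst hij
      simp only [M, Matrix.of_apply, hdiag, Matrix.diagonal_apply_eq]
    · rw [Matrix.diagonal_apply_ne _ hij]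
      change c * (hypergraphState E).amp (X (s i) (s j)) = 0
      rcases hs i j hij with h | h
      · rw [hoff h₁ h, mul_zero]
      · rw [hoff h₂ h, mul_zero]
  -- `M` is also a product of a `3 × 2` and a `2 × 3` matrix.
  have hdet : M.det = 0 := by
    rw [Matrix.det_fin_three]
    simp only [M, Matrix.of_apply, ← hPQ]
    ring
  rw [hM, Matrix.det_diagonal, Finset.prod_const] at hdet
  exact pow_ne_zero _ (mul_ne_zero hc hκ) hdet

lemma not_convertible_eprGraph {T : SimpleGraph V} [DecidableRel T.Adj] (hT : T.IsTree)
    (hV : 3 ≤ Fintype.card V) : ¬ Convertible (catState V) (eprGraph T) := by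
  obtain ⟨v, hv⟩ := exists_one_lt_degree_of_isTree hT hV
  obtain ⟨u, hu, w, hw, huw⟩ := Finset.one_lt_card.1 hv
  rw [SimpleGraph.mem_neighborFinset] at hu hw
  refine not_convertible_hypergraphState (v := v) (k₁ := ⟨s(v, u), hu⟩) (k₂ := ⟨s(v, w), hw⟩)
    (fun e => Finset.nonempty_iff_ne_empty.2 e.1.toFinset_ne_empty) ?_
    ⟨by simp, u, by simp, hu.ne'⟩ ⟨by simp, w, by simp, hw.ne'⟩
  intro h
  exact huw (Sym2.congr_right.1 (congrArg Subtype.val h))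

end Impossibility

end LOCC

theorem mainTheorem8 (n : ℕ) (hn : 3 ≤ n) :
    (∀ i j : Fin n, i ≠ j →
      LOCC.StrictlyWeaker (LOCC.eprPair i j) (LOCC.catState (Fin n))) ∧
    (∀ (T : SimpleGraph (Fin n)) [DecidableRel T.Adj], T.IsTree →
      LOCC.StrictlyWeaker (LOCC.catState (Fin n)) (LOCC.eprGraph T)) := by
  have : Nontrivial (Fin n) := Fin.nontrivial_iff_two_le.2 (by omega)
  refine ⟨fun i j _ => ⟨LOCC.convertible_catState_restrict {i, j} ⟨i, by simp⟩, ?_⟩,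
    fun T _ hT => ⟨LOCC.convertible_eprGraph_catState hT,
      LOCC.not_convertible_eprGraph hT (by simpa using hn)⟩⟩
  obtain ⟨w, hw⟩ : ∃ w : Fin n, w ∉ ({i, j} : Finset (Fin n)) := by
    by_contra! h
    have h1 := Finset.card_le_card fun w (_ : w ∈ Finset.univ) => h w
    have h2 : ({i, j} : Finset (Fin n)).card ≤ 2 := Finset.card_le_two
    rw [Finset.card_univ, Fintype.card_fin] at h1
    omega
  exact LOCC.not_convertible_catState hw
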